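/- Let $T\in(0,\infty)$ and let $W=(W(t))_{t\ge 0}$ be a one-dimensional Wiener process on a probability space $(\Omega,\Sigma,\mathbb P)$. Let $C([0,T])$ be the space of continuous functions $[0,T]\to\mathbb R$ with the supremum norm and its Borel $\sigma$-field. A method $\bar X=(\bar X_n)_{n\in\mathbb N}$, $\mathbb N=\{1,2,\dots\}$, is given by partitions $0=t_{0,n}<t_{1,n}<\dots<t_{n,n}=T$ and Borel maps $\varphi_n:\mathbb R^n\to C([0,T])$, through $$\bar X_n=\varphi_n\bigl(W(t_{1,n}),\dots,W(t_{n,n})\bigr).$$ Let $\chi^{\rm noneq}$ be the class of all such methods, with $n$th error $$e_n(\bar X)=\|W-\bar X_n\|_{L^2(\Omega\times[0,T])}=\Bigl(\mathbb E\int_0^T|W(t)-\bar X_n(t)|^2\,dt\Bigr)^{1/2}\in[0,\infty].$$ Let $\bar W^{\rm eq}=(\bar W^{\rm eq}_n)_{n\in\mathbb N}\in\chi^{\rm noneq}$ be the method whose $n$th partition is $t_i=iT/n$, $i=0,\dots,n$, and whose map $\varphi_n$ sends $(y_1,\dots,y_n)$ to the continuous piecewise linear function with value $0$ at $t_0=0$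 and value $y_i$ at $t_i$, $i=1,\dots,n$. Then, for every $n\in\mathbb N$: * almost surely, for all $i=0,\dots,n-1$ and all $t\in[t_i,t_{i+1}]$, $$\bar W^{\rm eq}_n(t)=\frac{(t-t_i)\,W(t_{i+1})+(t_{i+1}-t)\,W(t_i)}{t_{i+1}-t_i};$$ * $\mathbb E\int_0^T|\bar W^{\rm eq}_n(t)|^2\,dt<\infty$; * $\displaystyle e_n(\bar W^{\rm eq})=\inf_{\bar X\in\chi^{\rm noneq}}e_n(\bar X)=\frac{T}{\sqrt6}\,n^{-1/2}.$ In particular $\bar W^{\rm eq}$ is optimal in $\chi^{\rm noneq}$. -/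

import Mathlib

open MeasureTheory ProbabilityTheory
open scoped NNReal ENNReal

noncomputable section

namespace WienerRecon

/-- A point of the real interval `[0, T]`, seen as an element of the time axis `[0, ∞)`. -/
def timePt {T : ℝ} (t : Set.Icc (0 : ℝ) T) : ℝ≥0 := ⟨t, t.2.1⟩

/-- The `n`-th member of a reconstruction method: a partition `0 = t₀ < t₁ < ⋯ < tₙ = T` and a
Borel map `φ : ℝⁿ → C([0, T])`. The topology of `C(Set.Icc 0 T, ℝ)` is that of the supremum norm. -/
structure Algorithm (T : ℝ) (n : ℕ) where
  node : Fin (n + 1) → Set.Icc (0 : ℝ) T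
  node_strictMono : StrictMono node
  node_zero : (node 0 : ℝ) = 0
  node_last : (node (Fin.last n) : ℝ) = T
  φ : (Fin n → ℝ) → C(Set.Icc (0 : ℝ) T, ℝ)
  measurable_φ : Measurable[inferInstance, borel C(Set.Icc (0 : ℝ) T, ℝ)] φ

/-- A reconstruction method is a sequence of algorithms, the `n`-th one (`n = 1, 2, …`) using `n`
evaluations of the process. -/
abbrev Method (T : ℝ) : Type := ∀ n : ℕ+, Algorithm T n

/-- Lebesgue measure on `[0, T]`. -/
def lebesgueIcc (T : ℝ) : Measure (Set.Icc (0 : ℝ) T) := (volume : Measure ℝ).comap Subtype.val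

variable {Ω : Type*}

/-- The information `(W(t₁), …, W(tₙ))` used by an algorithm. -/
def Algorithm.info {T : ℝ} {n : ℕ} (A : Algorithm T n) (W : ℝ≥0 → Ω → ℝ) (ω : Ω) : Fin n → ℝ :=
  fun i => W (timePt (A.node i.succ)) ω

/-- The approximation `φ(W(t₁), …, W(tₙ))`, a random element of `C([0, T])`. -/
def Algorithm.approx {T : ℝ} {n : ℕ} (A : Algorithm T n) (W : ℝ≥0 → Ω → ℝ) (ω : Ω) :
    C(Set.Icc (0 : ℝ) T, ℝ) :=
  A.φ (A.info W ω)

/-- The `n`-th error of a method: the norm of `W - X̄ₙ` in `L²(Ω × [0, T])`, with values in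
`[0, ∞]`. -/
def error [MeasurableSpace Ω] {T : ℝ} (P : Measure Ω) (W : ℝ≥0 → Ω → ℝ) (X : Method T) (n : ℕ+) :
    ℝ≥0∞ :=
  eLpNorm (fun p : Ω × Set.Icc (0 : ℝ) T => W (timePt p.2) p.1 - (X n).approx W p.1 p.2) 2
    (P.prod (lebesgueIcc T))

/-- The `L²(Ω × [0, T])` norm of the `n`-th approximation itself. -/
def approxNorm [MeasurableSpace Ω] {T : ℝ} (P : Measure Ω) (W : ℝ≥0 → Ω → ℝ) (X : Method T)
    (n : ℕ+) : ℝ≥0∞ :=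
  eLpNorm (fun p : Ω × Set.Icc (0 : ℝ) T => (X n).approx W p.1 p.2) 2 (P.prod (lebesgueIcc T))

/-- The equidistant node `i T / n`. -/
def eqNode (T : ℝ) (n : ℕ) (i : ℕ) : ℝ := i * T / n

/-- The linear function through `(tᵢ, a)` and `(tᵢ₊₁, b)` for the equidistant mesh. -/
def segment (T : ℝ) (n : ℕ) (i : ℕ) (a b : ℝ) (t : ℝ) : ℝ :=
  ((t - eqNode T n i) * b + (eqNode T n (i + 1) - t) * a) / (eqNode T n (i + 1) - eqNode T n i)

/-- Piecewise linear interpolation at the equidistant nodes with value `0` at `t₀ = 0` and values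
`y₁, …, yₙ` at `t₁, …, tₙ`. The intervals are taken half-open, so that every node is counted
once. -/
def interp (T : ℝ) (n : ℕ) (y : Fin n → ℝ) (t : ℝ) : ℝ :=
  ∑ i : Fin n, (Set.Ioc (eqNode T n i) (eqNode T n (i + 1))).indicator
    (segment T n i ((Fin.cons 0 y : Fin (n + 1) → ℝ) i.castSucc)
      ((Fin.cons 0 y : Fin (n + 1) → ℝ) i.succ)) t

theorem eqNode_lt {T : ℝ} (hT : 0 < T) {n : ℕ} (hn : 0 < n) {i j : ℕ} (h : i < j) :
    eqNode T n i < eqNode T n j := by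
  unfold eqNode
  have : (0 : ℝ) < n := by exact_mod_cast hn
  have : (i : ℝ) < j := by exact_mod_cast h
  gcongr

theorem eqNode_le {T : ℝ} (hT : 0 < T) {n : ℕ} (hn : 0 < n) {i j : ℕ} (h : i ≤ j) :
    eqNode T n i ≤ eqNode T n j := by
  rcases h.eq_or_lt with rfl | h
  · exact le_rfl
  · exact (eqNode_lt hT hn h).le

theorem eqNode_zero (T : ℝ) (n : ℕ) : eqNode T n 0 = 0 := by simp [eqNode]

theorem eqNode_self (T : ℝ) {n : ℕ} (hn : 0 < n) : eqNode T n n = T := by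
  have : (n : ℝ) ≠ 0 := by exact_mod_cast hn.ne'
  simp only [eqNode]
  field_simp

theorem interp_eq_of_mem_Ioc {T : ℝ} (hT : 0 < T) {n : ℕ} (hn : 0 < n) (y : Fin n → ℝ)
    (k : Fin n) {t : ℝ} (ht : t ∈ Set.Ioc (eqNode T n k) (eqNode T n (k + 1))) :
    interp T n y t = segment T n k ((Fin.cons 0 y : Fin (n + 1) → ℝ) k.castSucc)
      ((Fin.cons 0 y : Fin (n + 1) → ℝ) k.succ) t := by
  unfold interp
  rw [Finset.sum_eq_single k]
  · exact Set.indicator_of_mem ht _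
  · intro j _ hj
    apply Set.indicator_of_notMem
    rintro ⟨h1, h2⟩
    rcases lt_or_gt_of_ne hj with h | h
    · have := eqNode_le hT hn (show (j : ℕ) + 1 ≤ k from h)
      linarith [ht.1]
    · have := eqNode_le hT hn (show (k : ℕ) + 1 ≤ j from h)
      linarith [ht.2]
  · simp

/-- On each closed mesh interval the interpolation is the linear function through the two adjacent
data points. -/
theorem interp_eq {T : ℝ} (hT : 0 < T) {n : ℕ} (hn : 0 < n) (y : Fin n → ℝ)
    (k : Fin n) {t : ℝ} (ht : t ∈ Set.Icc (eqNode T n k) (eqNode T n (k + 1))) :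
    interp T n y t = segment T n k ((Fin.cons 0 y : Fin (n + 1) → ℝ) k.castSucc)
      ((Fin.cons 0 y : Fin (n + 1) → ℝ) k.succ) t := by
  rcases ht.1.eq_or_lt with h | h
  · subst h
    have hk := sub_pos.2 (eqNode_lt hT hn (Nat.lt_succ_self (k : ℕ)))
    have hR : segment T n k ((Fin.cons 0 y : Fin (n + 1) → ℝ) k.castSucc)
        ((Fin.cons 0 y : Fin (n + 1) → ℝ) k.succ) (eqNode T n k)
        = (Fin.cons 0 y : Fin (n + 1) → ℝ) k.castSucc := by
      simp only [segment, sub_self, zero_mul, zero_add]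
      exact mul_div_cancel_left₀ _ hk.ne'
    rw [hR]
    obtain ⟨k, hkn⟩ := k
    cases k with
    | zero =>
      have h0 : (Fin.castSucc ⟨0, hkn⟩ : Fin (n + 1)) = 0 := rfl
      rw [h0, Fin.cons_zero]
      unfold interp
      refine Finset.sum_eq_zero fun i _ => Set.indicator_of_notMem ?_ _
      rintro ⟨h1, -⟩
      exact absurd (eqNode_le hT hn (Nat.zero_le (i : ℕ))) (not_le.2 h1)
    | succ m =>
      have hm := eqNode_lt hT hn (Nat.lt_succ_self m)
      rw [interp_eq_of_mem_Ioc hT hn y ⟨m, by omega⟩ ⟨hm, le_rfl⟩]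
      simp only [segment, sub_self, zero_mul, add_zero]
      rw [mul_div_cancel_left₀ _ (sub_pos.2 hm).ne']
      rfl
  · exact interp_eq_of_mem_Ioc hT hn y k ⟨h, ht.2⟩

theorem continuous_interp {T : ℝ} (hT : 0 < T) {n : ℕ} (hn : 0 < n) (y : Fin n → ℝ) :
    Continuous fun t : Set.Icc (0 : ℝ) T => interp T n y t := by
  refine LocallyFinite.continuous
    (f := fun k : Fin n => {t : Set.Icc (0 : ℝ) T |
      (t : ℝ) ∈ Set.Icc (eqNode T n k) (eqNode T n (k + 1))})
    (locallyFinite_of_finite _) ?_ (fun k => isClosed_Icc.preimage continuous_subtype_val) ?_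
  · refine Set.eq_univ_of_forall fun t => Set.mem_iUnion.2 ?_
    have key : ∀ m : ℕ, m ≤ n → (t : ℝ) ≤ eqNode T n m → 0 < m → ∃ k : Fin n,
        (t : ℝ) ∈ Set.Icc (eqNode T n k) (eqNode T n (k + 1)) := by
      intro m
      induction m with
      | zero => intro _ _ h; omega
      | succ m ih =>
        intro hm ht _
        by_cases h : eqNode T n m ≤ t
        · exact ⟨⟨m, hm⟩, h, ht⟩
        · rcases Nat.eq_zero_or_pos m with rfl | hm0
          · exact absurd (by rw [eqNode_zero]; exact t.2.1) h
          · exact ih (by omega) (not_le.1 h).le hm0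
    exact key n le_rfl (by rw [eqNode_self T hn]; exact t.2.2) hn
  · intro k
    refine ContinuousOn.congr (f := fun t : Set.Icc (0 : ℝ) T =>
      segment T n k ((Fin.cons 0 y : Fin (n + 1) → ℝ) k.castSucc)
        ((Fin.cons 0 y : Fin (n + 1) → ℝ) k.succ) t) ?_ fun t ht => interp_eq hT hn y k ht
    unfold segment
    fun_prop

/-- Piecewise linear interpolation as a linear map from the data to `C([0, T])`. -/
def interpLin {T : ℝ} (hT : 0 < T) {n : ℕ} (hn : 0 < n) :
    (Fin n → ℝ) →ₗ[ℝ] C(Set.Icc (0 : ℝ) T, ℝ) where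
  toFun y := ⟨fun t => interp T n y t, continuous_interp hT hn y⟩
  map_add' x y := by
    ext t
    simp only [ContinuousMap.coe_mk, ContinuousMap.add_apply, interp, ← Finset.sum_add_distrib]
    refine Finset.sum_congr rfl fun i _ => ?_
    have h : ∀ j, (Fin.cons 0 (x + y) : Fin (n + 1) → ℝ) j
        = (Fin.cons 0 x : Fin (n + 1) → ℝ) j + (Fin.cons 0 y : Fin (n + 1) → ℝ) j := by
      intro j; refine Fin.cases ?_ (fun j => ?_) j <;> simp
    simp only [Set.indicator_apply, h, segment]
    split_ifs <;> ring
  map_smul' c y := by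
    ext t
    simp only [ContinuousMap.coe_mk, ContinuousMap.smul_apply, interp, smul_eq_mul,
      Finset.mul_sum, RingHom.id_apply]
    refine Finset.sum_congr rfl fun i _ => ?_
    have h : ∀ j, (Fin.cons 0 (c • y) : Fin (n + 1) → ℝ) j
        = c * (Fin.cons 0 y : Fin (n + 1) → ℝ) j := by
      intro j; refine Fin.cases ?_ (fun j => ?_) j <;> simp
    simp only [Set.indicator_apply, h, segment]
    split_ifs <;> ring

/-- The method `W̄^eq`: piecewise linear interpolation of the data at the equidistant nodes
`i T / n`, `i = 0, …, n`. -/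
def linearEq {T : ℝ} (hT : 0 < T) : Method T := fun n =>
  { node := fun i => ⟨eqNode T n i,
      by rw [← eqNode_zero T n]; exact eqNode_le hT n.pos (Nat.zero_le _),
      (eqNode_le hT n.pos (Nat.lt_succ_iff.1 i.2)).trans_eq (eqNode_self T n.pos)⟩
    node_strictMono := fun _ _ h => eqNode_lt hT n.pos h
    node_zero := eqNode_zero T n
    node_last := eqNode_self T n.pos
    φ := interpLin hT n.pos
    measurable_φ := by
      let _ : MeasurableSpace C(Set.Icc (0 : ℝ) T, ℝ) := borel _
      have _ : BorelSpace C(Set.Icc (0 : ℝ) T, ℝ) := ⟨rfl⟩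
      exact (LinearMap.continuous_of_finiteDimensional (interpLin hT n.pos)).measurable }

end WienerRecon

end

/-!
On each interval `[s, u]` of a partition the Wiener process is the sum of its chord, which is a
function of the values at the nodes, and a Brownian bridge, which is independent of the values at
all nodes. Hence no function of the node values has at time `t` a mean square error below the
bridge variance `(t - s) (u - t) / (u - s)`, and linear interpolation attains it. Integrating over
`t` gives `∑ (u - s) ^ 2 / 6` for the least squared error of a given partition, and by
Cauchy–Schwarz this sum is smallest, namely `T ^ 2 / (6 n)`, for equidistant nodes.
-/

namespace WienerRecon

variable {Ω : Type*}

/-- The value at time `t` of the linear interpolation of the process `B` between the times `s` and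
`u`. -/
noncomputable def chord (B : ℝ≥0 → Ω → ℝ) (s u t : ℝ≥0) (ω : Ω) : ℝ :=
  (((t : ℝ) - s) * B u ω + ((u : ℝ) - t) * B s ω) / ((u : ℝ) - s)

/-- The deviation of the process `B` from its linear interpolation between the times `s` and `u`;
for a Brownian motion this is the Brownian bridge on `[s, u]`. -/
noncomputable def bridge (B : ℝ≥0 → Ω → ℝ) (s u t : ℝ≥0) (ω : Ω) : ℝ :=
  B t ω - chord B s u t ω

variable [MeasurableSpace Ω] {P : Measure Ω}

section BrownianBridge

variable {B : ℝ≥0 → Ω → ℝ} {s u t : ℝ≥0}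

theorem memLp_two_eval (hB : IsPreBrownianReal B P) (t : ℝ≥0) : MemLp (B t) 2 P :=
  (hB.isGaussianProcess.hasGaussianLaw_eval t).memLp_two

theorem variance_eval (hB : IsPreBrownianReal B P) (t : ℝ≥0) : Var[B t; P] = t := by
  rw [← covariance_self (hB.aemeasurable t), hB.covariance_eval, min_self]

theorem memLp_two_chord (hB : IsPreBrownianReal B P) (s u t : ℝ≥0) : MemLp (chord B s u t) 2 P := by
  unfold chord
  simp only [div_eq_mul_inv]
  exact (((memLp_two_eval hB u).const_mul _).add ((memLp_two_eval hB s).const_mul _)).mul_const _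

theorem memLp_two_bridge (hB : IsPreBrownianReal B P) (s u t : ℝ≥0) :
    MemLp (bridge B s u t) 2 P :=
  (memLp_two_eval hB t).sub (memLp_two_chord hB s u t)

theorem integral_bridge (hB : IsPreBrownianReal B P) (s u t : ℝ≥0) : P[bridge B s u t] = 0 := by
  have := hB.isGaussianProcess.isProbabilityMeasure
  have hint := hB.integrable_eval
  have hchord := (memLp_two_chord hB s u t).integrable one_le_two
  simp only [bridge]
  rw [integral_sub (hint t) hchord]
  simp only [chord]
  rw [integral_div, integral_add ((hint u).const_mul _) ((hint s).const_mul _),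
    integral_const_mul, integral_const_mul]
  simp [hB.integral_eval]

theorem covariance_chord_left (hB : IsPreBrownianReal B P) {X : Ω → ℝ} (hX : MemLp X 2 P)
    (s u t : ℝ≥0) :
    cov[chord B s u t, X; P]
      = (((t : ℝ) - s) * cov[B u, X; P] + ((u : ℝ) - t) * cov[B s, X; P]) / (u - s) := by
  have := hB.isGaussianProcess.isProbabilityMeasure
  unfold chord
  rw [covariance_fun_div_left, ← covariance_const_mul_left, ← covariance_const_mul_left]
  exact congrArg (· / _) (covariance_add_left ((memLp_two_eval hB u).const_mul _)
    ((memLp_two_eval hB s).const_mul _) hX)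

theorem covariance_bridge_left (hB : IsPreBrownianReal B P) {X : Ω → ℝ} (hX : MemLp X 2 P)
    (s u t : ℝ≥0) :
    cov[bridge B s u t, X; P] = cov[B t, X; P]
      - (((t : ℝ) - s) * cov[B u, X; P] + ((u : ℝ) - t) * cov[B s, X; P]) / (u - s) := by
  have := hB.isGaussianProcess.isProbabilityMeasure
  unfold bridge
  rw [covariance_fun_sub_left (memLp_two_eval hB t) (memLp_two_chord hB s u t) hX,
    covariance_chord_left hB hX]

theorem covariance_bridge_eval_eq_zero (hB : IsPreBrownianReal B P) (hsu : s < u)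
    (ht : t ∈ Set.Icc s u) {r : ℝ≥0} (hr : r ∉ Set.Ioo s u) :
    cov[bridge B s u t, B r; P] = 0 := by
  have hne : (u : ℝ) - s ≠ 0 := sub_ne_zero.2 (by exact_mod_cast hsu.ne')
  rw [covariance_bridge_left hB (memLp_two_eval hB r)]
  simp only [hB.covariance_eval]
  rcases le_or_gt r s with hrs | hsr
  · rw [min_eq_right hrs, min_eq_right (hrs.trans ht.1), min_eq_right (hrs.trans hsu.le)]
    field_simp
    ring
  · have hur : u ≤ r := not_lt.1 fun h => hr ⟨hsr, h⟩
    rw [min_eq_left hur, min_eq_left (ht.2.trans hur), min_eq_left hsr.le]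
    field_simp
    ring

theorem variance_bridge (hB : IsPreBrownianReal B P) (hsu : s < u) (ht : t ∈ Set.Icc s u) :
    Var[bridge B s u t; P] = ((t : ℝ) - s) * (u - t) / (u - s) := by
  have hne : (u : ℝ) - s ≠ 0 := sub_ne_zero.2 (by exact_mod_cast hsu.ne')
  have hmem := memLp_two_bridge hB s u t
  rw [← covariance_self hmem.aemeasurable, covariance_bridge_left hB hmem,
    covariance_comm (B u), covariance_comm (B s),
    covariance_bridge_eval_eq_zero hB hsu ht Set.right_notMem_Ioo,
    covariance_bridge_eval_eq_zero hB hsu ht Set.left_notMem_Ioo, covariance_comm,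
    covariance_bridge_left hB (memLp_two_eval hB t)]
  simp only [hB.covariance_eval, min_self, min_eq_left ht.1, min_eq_right ht.2]
  field_simp
  ring

theorem isGaussianProcess_sumElim_bridge (hB : IsPreBrownianReal B P) (s u : ℝ≥0) {ι κ : Type*}
    (σ : ι → ℝ≥0) (τ : κ → ℝ≥0) :
    IsGaussianProcess (Sum.elim (fun i => bridge B s u (σ i)) fun k => B (τ k)) P := by
  classical
  refine hB.isGaussianProcess.of_isGaussianProcess ?_
  rintro (i | k)
  · let proj (r : ({s, u, σ i} : Finset ℝ≥0)) :=
      ContinuousLinearMap.proj (R := ℝ) (φ := fun _ : ({s, u, σ i} : Finset ℝ≥0) => ℝ) r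
    refine ⟨{s, u, σ i}, proj ⟨σ i, by simp⟩ - ((u : ℝ) - s)⁻¹ •
      (((σ i : ℝ) - s) • proj ⟨u, by simp⟩ + ((u : ℝ) - σ i) • proj ⟨s, by simp⟩), fun ω => ?_⟩
    simp [proj, bridge, chord, div_eq_inv_mul, mul_add]
  · exact ⟨{τ k}, ContinuousLinearMap.proj (R := ℝ) ⟨τ k, by simp⟩, fun ω => by simp⟩

theorem indepFun_bridge (hB : IsPreBrownianReal B P) (hsu : s < u) :
    IndepFun (fun ω (t : Set.Icc s u) => bridge B s u t ω)
      (fun ω (r : ↥(Set.Ioo s u)ᶜ) => B r ω) P :=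
  IsGaussianProcess.indepFun_of_covariance_eq_zero
    (isGaussianProcess_sumElim_bridge hB s u Subtype.val Subtype.val)
    (fun t => (memLp_two_bridge hB s u t).aemeasurable) (fun r => hB.aemeasurable r)
    fun t r => covariance_bridge_eval_eq_zero hB hsu t.2 r.2

end BrownianBridge

section SecondMoment

theorem lintegral_enorm_sq_eq_ofReal_variance [IsProbabilityMeasure P] {X : Ω → ℝ}
    (hX : MemLp X 2 P) (hX0 : P[X] = 0) : ∫⁻ ω, ‖X ω‖ₑ ^ 2 ∂P = ENNReal.ofReal Var[X; P] := by
  rw [hX.ofReal_variance_eq, evariance_def' hX.aestronglyMeasurable, hX0]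
  simp

theorem ofReal_variance_le_lintegral_enorm_add_sq [IsProbabilityMeasure P] {X Y : Ω → ℝ}
    (hX : MemLp X 2 P) (hY : AEMeasurable Y P) (hXY : IndepFun X Y P) :
    ENNReal.ofReal Var[X; P] ≤ ∫⁻ ω, ‖X ω + Y ω‖ₑ ^ 2 ∂P := by
  have hsum : AEStronglyMeasurable (X + Y) P := hX.1.add hY.aestronglyMeasurable
  suffices ENNReal.ofReal Var[X; P] ≤ eVar[X + Y; P] from
    this.trans ((evariance_def' hsum).trans_le tsub_le_self)
  by_cases hmem : MemLp (X + Y) 2 P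
  · have hY2 : MemLp Y 2 P := by simpa using hmem.sub hX
    rw [← hmem.ofReal_variance_eq, hXY.variance_add hX hY2]
    exact ENNReal.ofReal_le_ofReal (le_add_of_nonneg_right (variance_nonneg Y P))
  · exact (evariance_eq_top hsum hmem).symm ▸ le_top

theorem eLpNorm_two_sq_prod {S E : Type*} [MeasurableSpace S] {ν : Measure S} [SFinite P]
    [SFinite ν] [NormedAddCommGroup E] {f : Ω × S → E}
    (hf : AEStronglyMeasurable f (P.prod ν)) :
    eLpNorm f 2 (P.prod ν) ^ 2 = ∫⁻ t, ∫⁻ ω, ‖f (ω, t)‖ₑ ^ 2 ∂P ∂ν := by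
  rw [← lintegral_prod_symm _ (hf.enorm.pow_const 2)]
  simpa using eLpNorm_nnreal_pow_eq_lintegral (f := f) (μ := P.prod ν) (two_ne_zero (α := ℝ≥0))

end SecondMoment

section JointMeasurability

-- The approximants freeze the time argument to a simple function, so that only countably many
-- marginals, hence only countably many null sets, are involved.
theorem aemeasurable_uncurry_of_ae_continuous {ι β : Type*} [TopologicalSpace ι]
    [TopologicalSpace.PseudoMetrizableSpace ι] [MeasurableSpace ι] [SecondCountableTopology ι]
    [OpensMeasurableSpace ι] [TopologicalSpace β] [TopologicalSpace.PseudoMetrizableSpace β]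
    [MeasurableSpace β] [BorelSpace β] {ν : Measure ι} [SFinite ν] {X : ι → Ω → β}
    (hX : ∀ t, AEMeasurable (X t) P) (hcont : ∀ᵐ ω ∂P, Continuous fun t => X t ω) :
    AEMeasurable (fun p : Ω × ι => X p.2 p.1) (P.prod ν) := by
  choose V hV hXV using hX
  have hid : StronglyMeasurable (id : ι → ι) := stronglyMeasurable_id
  have hmeas (k : ℕ) : Measurable fun p : Ω × ι => V (hid.approx k p.2) p.1 :=
    ((hid.approx k).comp Prod.snd measurable_snd).measurable_bind (fun t p => V t p.1)
      fun t => (hV t).comp measurable_fst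
  refine aemeasurable_of_tendsto_metrizable_ae Filter.atTop (fun k => (hmeas k).aemeasurable) ?_
  have hXV_range : ∀ᵐ ω ∂P, ∀ k, ∀ t ∈ (hid.approx k).range, X t ω = V t ω :=
    ae_all_iff.2 fun k => (Finset.eventually_all _).2 fun t _ => hXV t
  filter_upwards [Measure.quasiMeasurePreserving_fst.ae hXV_range,
    Measure.quasiMeasurePreserving_fst.ae hcont] with p hp hcont_p
  refine ((hcont_p.tendsto p.2).comp (hid.tendsto_approx p.2)).congr fun k => ?_
  exact hp k _ (SimpleFunc.mem_range_self _ _)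

end JointMeasurability

section Partition

theorem sum_setLIntegral_Ioc_succ {α : Type*} [LinearOrder α] [TopologicalSpace α]
    [OrderClosedTopology α] [MeasurableSpace α] [OpensMeasurableSpace α] (μ : Measure α)
    (f : α → ℝ≥0∞) {n : ℕ} {τ : Fin (n + 1) → α} (hτ : Monotone τ) :
    ∑ i : Fin n, ∫⁻ x in Set.Ioc (τ i.castSucc) (τ i.succ), f x ∂μ
      = ∫⁻ x in Set.Ioc (τ 0) (τ (Fin.last n)), f x ∂μ := by
  induction n with
  | zero => simp
  | succ n ih =>
    have hlast : τ (Fin.last n).castSucc ≤ τ (Fin.last (n + 1)) := hτ (Fin.le_last _)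
    have hsum := ih (hτ.comp Fin.strictMono_castSucc.monotone)
    simp only [Function.comp_apply, Fin.castSucc_zero, ← Fin.succ_castSucc] at hsum
    rw [Fin.sum_univ_castSucc, hsum, Fin.succ_last, ← lintegral_union measurableSet_Ioc
      (Set.Ioc_disjoint_Ioc_of_le le_rfl), Set.Ioc_union_Ioc_eq_Ioc (hτ (Fin.zero_le _)) hlast]

theorem sq_sub_le_mul_sum_sq_sub {n : ℕ} (τ : Fin (n + 1) → ℝ) :
    (τ (Fin.last n) - τ 0) ^ 2 ≤ n * ∑ i : Fin n, (τ i.succ - τ i.castSucc) ^ 2 := by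
  have htelescope : ∑ i : Fin n, (τ i.succ - τ i.castSucc) = τ (Fin.last n) - τ 0 := by
    rw [Finset.sum_sub_distrib]
    linarith [Fin.sum_univ_succ τ, Fin.sum_univ_castSucc τ]
  simpa [htelescope] using sq_sum_le_card_mul_sum_sq (s := Finset.univ)
    (f := fun i : Fin n => τ i.succ - τ i.castSucc)

theorem integral_sub_mul_sub (a b : ℝ) : ∫ t in a..b, (t - a) * (b - t) = (b - a) ^ 3 / 6 := by
  have hshift := intervalIntegral.integral_comp_sub_right (a := a) (b := b)
    (fun x => (b - a) * x - x ^ 2) a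
  calc ∫ t in a..b, (t - a) * (b - t)
      = ∫ t in a..b, ((b - a) * (t - a) - (t - a) ^ 2) := by congr 1; ext t; ring
    _ = ∫ x in (0 : ℝ)..(b - a), ((b - a) * x - x ^ 2) := by rw [hshift, sub_self]
    _ = (b - a) ^ 3 / 6 := by
        rw [intervalIntegral.integral_sub (Continuous.intervalIntegrable (by fun_prop) _ _)
          (Continuous.intervalIntegrable (by fun_prop) _ _), intervalIntegral.integral_const_mul,
          integral_id, integral_pow]
        ring

theorem setLIntegral_Ioc_sub_mul_sub_div {a b : ℝ} (hab : a ≤ b) :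
    ∫⁻ t in Set.Ioc a b, ENNReal.ofReal ((t - a) * (b - t) / (b - a))
      = ENNReal.ofReal ((b - a) ^ 2 / 6) := by
  rw [← ofReal_integral_eq_lintegral_ofReal, ← intervalIntegral.integral_of_le hab,
    intervalIntegral.integral_div, integral_sub_mul_sub]
  · congr 1
    rcases eq_or_ne (b - a) 0 with h | h
    · simp [h]
    · field_simp
  · exact (Continuous.integrableOn_Icc (by fun_prop)).mono_set Set.Ioc_subset_Icc_self
  · filter_upwards [ae_restrict_mem measurableSet_Ioc] with t ht
    exact div_nonneg (mul_nonneg (sub_nonneg.2 ht.1.le) (sub_nonneg.2 ht.2)) (sub_nonneg.2 hab)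

end Partition

section TimeInterval

variable {T : ℝ}

instance isFiniteMeasure_lebesgueIcc : IsFiniteMeasure (lebesgueIcc T) where
  measure_univ_lt_top := by
    rw [lebesgueIcc, (MeasurableEmbedding.subtype_coe measurableSet_Icc).comap_apply]
    exact (measure_mono (Subtype.coe_image_subset _ _)).trans_lt measure_Icc_lt_top

instance nullSingletonClass_lebesgueIcc : NullSingletonClass (lebesgueIcc T) where
  measure_singleton t := by
    rw [lebesgueIcc, (MeasurableEmbedding.subtype_coe measurableSet_Icc).comap_apply,
      Set.image_singleton, measure_singleton]

theorem continuous_timePt : Continuous (timePt (T := T)) :=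
  continuous_subtype_val.subtype_mk _

theorem setLIntegral_Ioc_lebesgueIcc {f : ℝ → ℝ≥0∞} (hf : Measurable f) (s u : Set.Icc (0 : ℝ) T) :
    ∫⁻ t in Set.Ioc s u, f t ∂lebesgueIcc T = ∫⁻ t in Set.Ioc (s : ℝ) u, f t := by
  have hsub : Set.Ioc (s : ℝ) u ⊆ Set.Icc 0 T := fun t ht =>
    ⟨s.2.1.trans ht.1.le, ht.2.trans u.2.2⟩
  have h := (measurePreserving_subtype_coe (μa := volume) measurableSet_Icc
    (s := Set.Icc 0 T)).setLIntegral_comp_preimage (measurableSet_Ioc (a := (s : ℝ)) (b := u)) hf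
  rwa [Measure.restrict_restrict measurableSet_Ioc, Set.inter_eq_left.2 hsub] at h

theorem setLIntegral_lebesgueIcc_bridgeVariance {s u : Set.Icc (0 : ℝ) T} (hsu : s ≤ u) :
    ∫⁻ t in Set.Ioc s u, ENNReal.ofReal (((t : ℝ) - s) * (u - t) / (u - s)) ∂lebesgueIcc T
      = ENNReal.ofReal (((u : ℝ) - s) ^ 2 / 6) := by
  rw [setLIntegral_Ioc_lebesgueIcc
    (f := fun t => ENNReal.ofReal ((t - s) * (u - t) / (u - s))) (by fun_prop)]
  exact setLIntegral_Ioc_sub_mul_sub_div hsu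

theorem memLp_two_uncurry_eval {W : ℝ≥0 → Ω → ℝ} (hW : IsPreBrownianReal W P)
    (hmeas : AEMeasurable (fun p : Ω × Set.Icc (0 : ℝ) T => W (timePt p.2) p.1)
      (P.prod (lebesgueIcc T))) :
    MemLp (fun p : Ω × Set.Icc (0 : ℝ) T => W (timePt p.2) p.1) 2 (P.prod (lebesgueIcc T)) := by
  have := hW.isGaussianProcess.isProbabilityMeasure
  refine ⟨hmeas.aestronglyMeasurable, (ENNReal.pow_lt_top_iff (n := 2)).1 ?_ |>.resolve_right
    two_ne_zero⟩
  have hsecond_le (t : Set.Icc (0 : ℝ) T) :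
      ∫⁻ ω, ‖W (timePt t) ω‖ₑ ^ 2 ∂P ≤ ENNReal.ofReal T := by
    rw [lintegral_enorm_sq_eq_ofReal_variance (memLp_two_eval hW _) (hW.integral_eval _),
      variance_eval hW]
    exact ENNReal.ofReal_le_ofReal t.2.2
  calc eLpNorm (fun p : Ω × Set.Icc (0 : ℝ) T => W (timePt p.2) p.1) 2 (P.prod (lebesgueIcc T)) ^ 2
      = ∫⁻ t, ∫⁻ ω, ‖W (timePt t) ω‖ₑ ^ 2 ∂P ∂lebesgueIcc T :=
        eLpNorm_two_sq_prod hmeas.aestronglyMeasurable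
    _ ≤ ∫⁻ _, ENNReal.ofReal T ∂lebesgueIcc T := lintegral_mono hsecond_le
    _ < ∞ := by
        rw [lintegral_const]
        exact ENNReal.mul_lt_top ENNReal.ofReal_lt_top (measure_lt_top _ _)

end TimeInterval

namespace Algorithm

variable {T : ℝ} {n : ℕ} {W : ℝ≥0 → Ω → ℝ}

/-- The error of a single algorithm: the norm of `W - φ(W(t₁), …, W(tₙ))` in `L²(Ω × [0, T])`. -/
noncomputable def error (A : Algorithm T n) (P : Measure Ω) (W : ℝ≥0 → Ω → ℝ) : ℝ≥0∞ :=
  eLpNorm (fun p : Ω × Set.Icc (0 : ℝ) T => W (timePt p.2) p.1 - A.approx W p.1 p.2) 2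
    (P.prod (lebesgueIcc T))

/-- The mean square error of an algorithm at a fixed time. -/
noncomputable def meanSquareError (A : Algorithm T n) (P : Measure Ω) (W : ℝ≥0 → Ω → ℝ)
    (t : Set.Icc (0 : ℝ) T) : ℝ≥0∞ :=
  ∫⁻ ω, ‖W (timePt t) ω - A.approx W ω t‖ₑ ^ 2 ∂P

/-- The approximation is almost surely the piecewise linear interpolation of the process at all
nodes, including `t₀ = 0`, where the algorithm does not observe the process. -/
def InterpolatesLinearly (A : Algorithm T n) (P : Measure Ω) (W : ℝ≥0 → Ω → ℝ) : Prop :=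
  ∀ᵐ ω ∂P, ∀ i : Fin n, ∀ t : Set.Icc (0 : ℝ) T, A.node i.castSucc ≤ t → t ≤ A.node i.succ →
    A.approx W ω t = chord W (timePt (A.node i.castSucc)) (timePt (A.node i.succ)) (timePt t) ω

theorem measurable_uncurry_φ (A : Algorithm T n) :
    Measurable fun q : Set.Icc (0 : ℝ) T × (Fin n → ℝ) => A.φ q.2 q.1 := by
  let _ : MeasurableSpace C(Set.Icc (0 : ℝ) T, ℝ) := borel _
  have _ : BorelSpace C(Set.Icc (0 : ℝ) T, ℝ) := ⟨rfl⟩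
  exact measurable_uncurry_of_continuous_of_measurable (u := fun t y => A.φ y t)
    (fun y => (A.φ y).continuous)
    fun t => (continuous_eval_const (F := C(Set.Icc (0 : ℝ) T, ℝ)) t).measurable.comp A.measurable_φ

theorem aemeasurable_approx (A : Algorithm T n) (hW : ∀ t, AEMeasurable (W t) P) :
    AEMeasurable (fun p : Ω × Set.Icc (0 : ℝ) T => A.approx W p.1 p.2)
      (P.prod (lebesgueIcc T)) := by
  have hinfo : AEMeasurable (A.info W) P := aemeasurable_pi_lambda _ fun i => hW _
  exact A.measurable_uncurry_φ.comp_aemeasurable (measurable_snd.aemeasurable.prodMk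
    (hinfo.comp_quasiMeasurePreserving Measure.quasiMeasurePreserving_fst))

theorem timePt_node_notMem_Ioo (A : Algorithm T n) (j : Fin (n + 1)) (i : Fin n) :
    timePt (A.node j) ∉ Set.Ioo (timePt (A.node i.castSucc)) (timePt (A.node i.succ)) := by
  rintro ⟨hleft, hright⟩
  have hij : i.castSucc < j := A.node_strictMono.lt_iff_lt.1 hleft
  have hji : j < i.succ := A.node_strictMono.lt_iff_lt.1 hright
  exact hji.not_ge hij

theorem indepFun_bridge_nodes (A : Algorithm T n) (hW : IsPreBrownianReal W P) (i : Fin n)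
    {t : Set.Icc (0 : ℝ) T} (ht : t ∈ Set.Icc (A.node i.castSucc) (A.node i.succ)) :
    IndepFun (bridge W (timePt (A.node i.castSucc)) (timePt (A.node i.succ)) (timePt t))
      (fun ω j => W (timePt (A.node j)) ω) P :=
  (indepFun_bridge hW (A.node_strictMono i.castSucc_lt_succ)).comp
    (measurable_pi_apply (⟨timePt t, ht⟩ : Set.Icc (timePt _) (timePt _)))
    (measurable_pi_lambda _ fun j => measurable_pi_apply
      (⟨timePt (A.node j), A.timePt_node_notMem_Ioo j i⟩ : ↥(Set.Ioo (timePt _) (timePt _))ᶜ))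

theorem ofReal_bridgeVariance_le_meanSquareError (A : Algorithm T n) (hW : IsPreBrownianReal W P)
    (i : Fin n) {t : Set.Icc (0 : ℝ) T} (ht : t ∈ Set.Icc (A.node i.castSucc) (A.node i.succ)) :
    ENNReal.ofReal (((t : ℝ) - A.node i.castSucc) * (A.node i.succ - t)
      / (A.node i.succ - A.node i.castSucc)) ≤ A.meanSquareError P W t := by
  have := hW.isGaussianProcess.isProbabilityMeasure
  let correction (y : Fin (n + 1) → ℝ) : ℝ :=
    (((t : ℝ) - A.node i.castSucc) * y i.succ + ((A.node i.succ : ℝ) - t) * y i.castSucc)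
      / ((A.node i.succ : ℝ) - A.node i.castSucc) - A.φ (fun j => y j.succ) t
  have hcorrection : Measurable correction := by
    have hφ : Measurable fun y : Fin (n + 1) → ℝ => A.φ (fun j => y j.succ) t :=
      A.measurable_uncurry_φ.comp (measurable_const.prodMk (by fun_prop))
    fun_prop
  have hnodes : AEMeasurable (fun ω j => W (timePt (A.node j)) ω) P :=
    aemeasurable_pi_lambda _ fun j => hW.aemeasurable _
  calc ENNReal.ofReal _
      = ENNReal.ofReal
          Var[bridge W (timePt (A.node i.castSucc)) (timePt (A.node i.succ)) (timePt t); P] :=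
        congrArg ENNReal.ofReal
          (variance_bridge hW (A.node_strictMono i.castSucc_lt_succ) ht).symm
    _ ≤ ∫⁻ ω, ‖bridge W (timePt (A.node i.castSucc)) (timePt (A.node i.succ)) (timePt t) ω
          + correction (fun j => W (timePt (A.node j)) ω)‖ₑ ^ 2 ∂P :=
        ofReal_variance_le_lintegral_enorm_add_sq (memLp_two_bridge hW _ _ _)
          (hcorrection.comp_aemeasurable hnodes)
          ((A.indepFun_bridge_nodes hW i ht).comp measurable_id hcorrection)
    _ = A.meanSquareError P W t :=
        lintegral_congr fun ω => congrArg (‖·‖ₑ ^ 2) (sub_add_sub_cancel _ _ _)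

theorem InterpolatesLinearly.meanSquareError_eq {A : Algorithm T n}
    (hA : A.InterpolatesLinearly P W) (hW : IsPreBrownianReal W P) (i : Fin n)
    {t : Set.Icc (0 : ℝ) T} (ht : t ∈ Set.Icc (A.node i.castSucc) (A.node i.succ)) :
    A.meanSquareError P W t = ENNReal.ofReal (((t : ℝ) - A.node i.castSucc) * (A.node i.succ - t)
      / (A.node i.succ - A.node i.castSucc)) := by
  have := hW.isGaussianProcess.isProbabilityMeasure
  calc A.meanSquareError P W t
      = ∫⁻ ω, ‖bridge W (timePt (A.node i.castSucc)) (timePt (A.node i.succ)) (timePt t) ω‖ₑ ^ 2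
          ∂P := by
        refine lintegral_congr_ae ?_
        filter_upwards [hA] with ω hω
        rw [hω i t ht.1 ht.2, bridge]
    _ = ENNReal.ofReal _ := lintegral_enorm_sq_eq_ofReal_variance (memLp_two_bridge hW _ _ _)
        (integral_bridge hW _ _ _)
    _ = _ := congrArg ENNReal.ofReal
        (variance_bridge hW (A.node_strictMono i.castSucc_lt_succ) ht)

theorem error_sq_eq_sum (A : Algorithm T n) (hW : IsPreBrownianReal W P)
    (hmeas : AEMeasurable (fun p : Ω × Set.Icc (0 : ℝ) T => W (timePt p.2) p.1)
      (P.prod (lebesgueIcc T))) :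
    A.error P W ^ 2 = ∑ i : Fin n,
      ∫⁻ t in Set.Ioc (A.node i.castSucc) (A.node i.succ), A.meanSquareError P W t
        ∂lebesgueIcc T := by
  have := hW.isGaussianProcess.isProbabilityMeasure
  have hnodes : Set.Icc (A.node 0) (A.node (Fin.last n)) = Set.univ :=
    Set.eq_univ_of_forall fun t => ⟨A.node_zero.trans_le t.2.1, t.2.2.trans_eq A.node_last.symm⟩
  rw [sum_setLIntegral_Ioc_succ _ _ A.node_strictMono.monotone,
    setLIntegral_congr Ioc_ae_eq_Icc, hnodes, setLIntegral_univ]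
  exact eLpNorm_two_sq_prod (hmeas.sub (A.aemeasurable_approx hW.aemeasurable)).aestronglyMeasurable

theorem ofReal_sum_sq_le_error_sq (A : Algorithm T n) (hW : IsPreBrownianReal W P)
    (hmeas : AEMeasurable (fun p : Ω × Set.Icc (0 : ℝ) T => W (timePt p.2) p.1)
      (P.prod (lebesgueIcc T))) :
    ENNReal.ofReal (∑ i : Fin n, ((A.node i.succ : ℝ) - A.node i.castSucc) ^ 2 / 6)
      ≤ A.error P W ^ 2 := by
  rw [A.error_sq_eq_sum hW hmeas, ENNReal.ofReal_sum_of_nonneg fun i _ => by positivity]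
  refine Finset.sum_le_sum fun i _ => ?_
  rw [← setLIntegral_lebesgueIcc_bridgeVariance (A.node_strictMono i.castSucc_lt_succ).le]
  exact setLIntegral_mono' measurableSet_Ioc fun t ht =>
    A.ofReal_bridgeVariance_le_meanSquareError hW i (Set.Ioc_subset_Icc_self ht)

theorem InterpolatesLinearly.error_sq_eq {A : Algorithm T n} (hA : A.InterpolatesLinearly P W)
    (hW : IsPreBrownianReal W P)
    (hmeas : AEMeasurable (fun p : Ω × Set.Icc (0 : ℝ) T => W (timePt p.2) p.1)
      (P.prod (lebesgueIcc T))) :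
    A.error P W ^ 2
      = ENNReal.ofReal (∑ i : Fin n, ((A.node i.succ : ℝ) - A.node i.castSucc) ^ 2 / 6) := by
  rw [A.error_sq_eq_sum hW hmeas, ENNReal.ofReal_sum_of_nonneg fun i _ => by positivity]
  refine Finset.sum_congr rfl fun i _ => ?_
  rw [← setLIntegral_lebesgueIcc_bridgeVariance (A.node_strictMono i.castSucc_lt_succ).le]
  exact setLIntegral_congr_fun measurableSet_Ioc fun t ht =>
    hA.meanSquareError_eq hW i (Set.Ioc_subset_Icc_self ht)

theorem sq_div_le_sum_sq (A : Algorithm T n) :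
    T ^ 2 / (6 * n) ≤ ∑ i : Fin n, ((A.node i.succ : ℝ) - A.node i.castSucc) ^ 2 / 6 := by
  have h := sq_sub_le_mul_sum_sq_sub fun i => (A.node i : ℝ)
  rw [A.node_zero, A.node_last, sub_zero] at h
  rw [← Finset.sum_div]
  exact div_le_of_le_mul₀ (by positivity) (by positivity) (by linarith)

theorem memLp_two_approx (A : Algorithm T n) (hW : IsPreBrownianReal W P)
    (hmeas : AEMeasurable (fun p : Ω × Set.Icc (0 : ℝ) T => W (timePt p.2) p.1)
      (P.prod (lebesgueIcc T))) (hA : A.error P W < ∞) :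
    MemLp (fun p : Ω × Set.Icc (0 : ℝ) T => A.approx W p.1 p.2) 2 (P.prod (lebesgueIcc T)) := by
  have hsub := hmeas.sub (A.aemeasurable_approx hW.aemeasurable)
  simpa only [sub_sub_cancel, Pi.sub_def] using
    (memLp_two_uncurry_eval hW hmeas).sub ⟨hsub.aestronglyMeasurable, hA⟩

end Algorithm

section LinearEq

variable {T : ℝ} {W : ℝ≥0 → Ω → ℝ}

theorem interpolatesLinearly_linearEq (hW : IsPreBrownianReal W P) (hT : 0 < T) (n : ℕ+) :
    (linearEq hT n).InterpolatesLinearly P W := by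
  set A := linearEq hT n
  filter_upwards [hW.eval_zero_ae_eq_zero] with ω hω i t hl hr
  have hdata (j : Fin (n + 1)) :
      (Fin.cons 0 (A.info W ω) : Fin (n + 1) → ℝ) j = W (timePt (A.node j)) ω := by
    cases j using Fin.cases with
    | zero => rw [show timePt (A.node 0) = 0 from NNReal.eq A.node_zero, hω, Fin.cons_zero]
    | succ j => rfl
  refine (interp_eq hT n.pos (A.info W ω) i ⟨hl, hr⟩).trans ?_
  rw [hdata, hdata]
  rfl

theorem node_linearEq_succ_sub (hT : 0 < T) (n : ℕ+) (i : Fin n) :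
    ((linearEq hT n).node i.succ : ℝ) - (linearEq hT n).node i.castSucc = T / n := by
  simp only [linearEq, eqNode, Fin.val_succ, Fin.val_castSucc]
  push_cast
  ring

theorem error_linearEq_sq (hW : IsPreBrownianReal W P)
    (hmeas : AEMeasurable (fun p : Ω × Set.Icc (0 : ℝ) T => W (timePt p.2) p.1)
      (P.prod (lebesgueIcc T))) (hT : 0 < T) (n : ℕ+) :
    (linearEq hT n).error P W ^ 2 = ENNReal.ofReal (T ^ 2 / (6 * n)) := by
  rw [(interpolatesLinearly_linearEq hW hT n).error_sq_eq hW hmeas]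
  simp only [node_linearEq_succ_sub, Finset.sum_const, Finset.card_univ, Fintype.card_fin,
    nsmul_eq_mul]
  congr 1
  field_simp

theorem error_linearEq_le (hW : IsPreBrownianReal W P)
    (hmeas : AEMeasurable (fun p : Ω × Set.Icc (0 : ℝ) T => W (timePt p.2) p.1)
      (P.prod (lebesgueIcc T))) (hT : 0 < T) (n : ℕ+) (A : Algorithm T n) :
    (linearEq hT n).error P W ≤ A.error P W := by
  refine (ENNReal.pow_le_pow_left_iff two_ne_zero).1 ?_
  calc (linearEq hT n).error P W ^ 2 = ENNReal.ofReal (T ^ 2 / (6 * n)) :=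
        error_linearEq_sq hW hmeas hT n
    _ ≤ ENNReal.ofReal (∑ i : Fin n, ((A.node i.succ : ℝ) - A.node i.castSucc) ^ 2 / 6) :=
        ENNReal.ofReal_le_ofReal A.sq_div_le_sum_sq
    _ ≤ A.error P W ^ 2 := A.ofReal_sum_sq_le_error_sq hW hmeas

theorem error_linearEq (hW : IsPreBrownianReal W P)
    (hmeas : AEMeasurable (fun p : Ω × Set.Icc (0 : ℝ) T => W (timePt p.2) p.1)
      (P.prod (lebesgueIcc T))) (hT : 0 < T) (n : ℕ+) :
    (linearEq hT n).error P W = ENNReal.ofReal (T / √6 * (n : ℝ) ^ (-(1 / 2) : ℝ)) := by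
  refine (ENNReal.pow_right_strictMono two_ne_zero).injective ?_
  rw [error_linearEq_sq hW hmeas hT n, ← ENNReal.ofReal_pow (by positivity), mul_pow, div_pow,
    Real.sq_sqrt (by norm_num), Real.rpow_neg (by positivity), ← Real.sqrt_eq_rpow, inv_pow,
    Real.sq_sqrt (by positivity)]
  congr 1
  field_simp

end LinearEq

end WienerRecon

theorem mainTheorem8_general {Ω : Type*} [MeasurableSpace Ω] (P : Measure Ω)
    (W : ℝ≥0 → Ω → ℝ) (hW : IsPreBrownianReal W P) (T : ℝ) (hT : 0 < T)
    (hmeas : AEMeasurable (fun p : Ω × Set.Icc (0 : ℝ) T => W (WienerRecon.timePt p.2) p.1)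
      (P.prod (WienerRecon.lebesgueIcc T))) :
    (∀ n : ℕ+,
      (∀ i : Fin (n + 1), ((WienerRecon.linearEq hT n).node i : ℝ) = i * T / n) ∧
      (∀ᵐ ω ∂P, ∀ i : Fin n, ∀ t : Set.Icc (0 : ℝ) T,
        let tl := (WienerRecon.linearEq hT n).node i.castSucc
        let tr := (WienerRecon.linearEq hT n).node i.succ
        tl ≤ t → t ≤ tr →
          (WienerRecon.linearEq hT n).approx W ω t
            = (((t : ℝ) - tl) * W (WienerRecon.timePt tr) ω
                + ((tr : ℝ) - t) * W (WienerRecon.timePt tl) ω) / ((tr : ℝ) - tl)) ∧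
      WienerRecon.approxNorm P W (WienerRecon.linearEq hT) n < ∞ ∧
      WienerRecon.error P W (WienerRecon.linearEq hT) n
        = ENNReal.ofReal (T / √6 * (n : ℝ) ^ (-(1 / 2) : ℝ)) ∧
      WienerRecon.error P W (WienerRecon.linearEq hT) n
        = ⨅ X : WienerRecon.Method T, WienerRecon.error P W X n) := by
  intro n
  have herror := WienerRecon.error_linearEq hW hmeas hT n
  refine ⟨fun i => rfl, WienerRecon.interpolatesLinearly_linearEq hW hT n,
    ((WienerRecon.linearEq hT n).memLp_two_approx hW hmeas ?_).2, herror,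
    le_antisymm (le_iInf fun X => WienerRecon.error_linearEq_le hW hmeas hT n (X n)) (iInf_le _ _)⟩
  rw [herror]
  exact ENNReal.ofReal_lt_top

theorem mainTheorem8 {Ω : Type*} [MeasurableSpace Ω] (P : Measure Ω) [IsProbabilityMeasure P]
    (W : ℝ≥0 → Ω → ℝ) (hW : IsBrownianReal W P) (T : ℝ) (hT : 0 < T) :
    (∀ n : ℕ+,
      -- `linearEq` is the piecewise linear interpolation of `W` on the equidistant mesh
      (∀ i : Fin (n + 1), ((WienerRecon.linearEq hT n).node i : ℝ) = i * T / n) ∧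
      (∀ᵐ ω ∂P, ∀ i : Fin n, ∀ t : Set.Icc (0 : ℝ) T,
        let tl := (WienerRecon.linearEq hT n).node i.castSucc
        let tr := (WienerRecon.linearEq hT n).node i.succ
        tl ≤ t → t ≤ tr →
          (WienerRecon.linearEq hT n).approx W ω t
            = (((t : ℝ) - tl) * W (WienerRecon.timePt tr) ω
                + ((tr : ℝ) - t) * W (WienerRecon.timePt tl) ω) / ((tr : ℝ) - tl)) ∧
      -- it is square integrable, its error is exact, and it is optimal among all methods
      WienerRecon.approxNorm P W (WienerRecon.linearEq hT) n < ∞ ∧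
      WienerRecon.error P W (WienerRecon.linearEq hT) n
        = ENNReal.ofReal (T / √6 * (n : ℝ) ^ (-(1 / 2) : ℝ)) ∧
      WienerRecon.error P W (WienerRecon.linearEq hT) n
        = ⨅ X : WienerRecon.Method T, WienerRecon.error P W X n) := by
  exact mainTheorem8_general P W hW.toIsPreBrownianReal T hT <|
    WienerRecon.aemeasurable_uncurry_of_ae_continuous (fun t => hW.aemeasurable _)
      (hW.cont.mono fun _ h => h.comp WienerRecon.continuous_timePt)
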